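/- Let $d\lambda(z)=\frac1\pi e^{-|z|^2}\,dA(z)$ be the Gaussian probability measure on $\mathbb C$ ($dA$ is area measure), and let $F^2$ be the Fock space of all entire functions in $L^2(\mathbb C,d\lambda)$. Complex square roots are defined by $\sqrt z=\sqrt{|z|}\,e^{i\theta/2}$ for $z=|z|e^{i\theta}$, $\theta\in(-\pi,\pi]$. For $(s,t)\in\mathbb C^2$ with $s\ne0$, let $T^{(s,t)}$ be the integral operator on $F^2$ given by $$T^{(s,t)}f(z)=\int_{\mathbb C}K^{(s,t)}(z,w)f(w)\,d\lambda(w),\qquad K^{(s,t)}(z,w)=\frac1{\sqrt s}\exp\left[\frac{tz^2-\overline{tw^2}+2z\overline w}{2s}\right],$$ on its natural domain of those $f\in F^2$ for which the integral converges absolutely for every $z\in\mathbb C$ and $T^{(s,t)}f\in F^2$. Let $H_n(x)=(-1)^ne^{x^2}\frac{d^n}{dx^n}e^{-x^2}$ be the $n$th Hermite polynomial. **Theorem D.** Let $s,t\in\mathbb C$ with $|s|^2=|t|^2+1$ and $|\mathrm{Re}\,s|<1$. Then the equation $$s\bar t\gamma^2+(s^2-1-|t|^2)\gamma-st=0$$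 has a unique solution $\gamma$ in the open unit disk. For this $\gamma$ we have $s+\bar t\gamma\neq0$ and $(s+\bar t\gamma)^2\ne1$, and there is a number $\rho>0$ with $$\rho^2=\frac{(1+\gamma)\left[(s-\bar t)(s+\bar t\gamma)-1\right]}{2\left[(s+\bar t\gamma)^2-1\right]}.$$ Moreover, for each integer $n\ge0$ the number $$\lambda_n=\frac1{\sqrt s}\,\sqrt{\frac{s}{s+\bar t\gamma}}\,\frac1{(s+\bar t\gamma)^n}$$ has modulus $1$ and is an eigenvalue of $T^{(s,t)}$, and the function $Q_n(z)e^{\gamma z^2/2}$ is a corresponding eigenvector in $F^2$, where the (absolutely convergent) integral $$Q_n(z)=\int_{\mathbb R}H_n\left(\frac x\rho\right)\exp\left[-\frac2{1+\gamma}\left(x-\frac{1+\gamma}2z\right)^2\right]dx$$ is a polynomial in $z$ of degree $n$. -/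

import Mathlib

noncomputable section

namespace FockIntegral

open MeasureTheory Complex

/-- The Gaussian probability measure `(1 / π) exp (-|z|²) dA(z)` on the complex plane. -/
def gaussian : Measure ℂ :=
  (volume : Measure ℂ).withDensity
    (fun z => ENNReal.ofReal (Real.pi⁻¹ * Real.exp (-‖z‖ ^ 2)))

/-- The square root `√|z| exp (i θ / 2)`, where `θ ∈ (-π, π]` is the argument of `z`. -/
def csqrt (z : ℂ) : ℂ := (Real.sqrt ‖z‖ : ℂ) * Complex.exp (I * (Complex.arg z : ℂ) / 2)

/-- The Fock space `F²`: the entire functions that are square integrable with respect to the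
Gaussian measure, with pointwise operations. -/
def Fock : Submodule ℂ (ℂ → ℂ) where
  carrier := {f | Differentiable ℂ f ∧ MemLp f 2 gaussian}
  zero_mem' := ⟨differentiable_const 0, MemLp.zero⟩
  add_mem' := fun hf hg => ⟨hf.1.add hg.1, hf.2.add hg.2⟩
  smul_mem' := fun c _ hf => ⟨hf.1.const_smul c, hf.2.const_smul c⟩

/-- The kernel `K^{(s,t)}(z, w)`. -/
def kernel (s t z w : ℂ) : ℂ :=
  1 / csqrt s *
    Complex.exp ((t * z ^ 2 - (starRingEnd ℂ) (t * w ^ 2) + 2 * z * (starRingEnd ℂ) w) / (2 * s))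

/-- The integral `T^{(s,t)} f (z) = ∫ K^{(s,t)}(z, w) f(w) dλ(w)` for a function `f` on `ℂ`. -/
def transform (s t : ℂ) (f : ℂ → ℂ) (z : ℂ) : ℂ :=
  ∫ w, kernel s t z w * f w ∂gaussian

/-- The operator `T^{(s,t)}` on the Fock space, on its natural domain: those `f ∈ F²` for which
the integral converges absolutely at every point and defines an element of `F²`. -/
def T (s t : ℂ) : Fock →ₗ.[ℂ] Fock where
  domain :=
    { carrier := {f | (∀ z, Integrable (fun w => kernel s t z w * (f : ℂ → ℂ) w) gaussian) ∧
        transform s t (f : ℂ → ℂ) ∈ Fock}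
      zero_mem' := by
        refine ⟨fun z => by simp, ?_⟩
        have h : transform s t (((0 : Fock) : ℂ → ℂ)) = 0 := by
          funext z; simp [transform]
        rw [h]; exact Fock.zero_mem
      add_mem' := by
        intro f g hf hg
        have h : transform s t ((f + g : Fock) : ℂ → ℂ) =
            transform s t (f : ℂ → ℂ) + transform s t (g : ℂ → ℂ) := by
          funext z
          simp only [transform, Submodule.coe_add, Pi.add_apply, mul_add]
          exact integral_add (hf.1 z) (hg.1 z)
        refine ⟨fun z => ?_, ?_⟩
        · simp only [Submodule.coe_add, Pi.add_apply, mul_add]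
          exact (hf.1 z).add (hg.1 z)
        · rw [h]; exact Fock.add_mem hf.2 hg.2
      smul_mem' := by
        intro c f hf
        have h : transform s t ((c • f : Fock) : ℂ → ℂ) = c • transform s t (f : ℂ → ℂ) := by
          funext z
          simp only [transform, Submodule.coe_smul, Pi.smul_apply, smul_eq_mul, mul_left_comm _ c]
          exact integral_const_mul c _
        refine ⟨fun z => ?_, ?_⟩
        · simpa [mul_left_comm _ c] using (hf.1 z).const_mul c
        · rw [h]; exact Fock.smul_mem c hf.2 }
  toFun :=
    { toFun := fun f => ⟨transform s t ((f : Fock) : ℂ → ℂ), f.2.2⟩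
      map_add' := by
        intro f g
        ext z
        simp only [transform, Submodule.coe_add, Pi.add_apply, mul_add]
        exact integral_add (f.2.1 z) (g.2.1 z)
      map_smul' := by
        intro c f
        ext z
        simp only [transform, Submodule.coe_smul, Pi.smul_apply, smul_eq_mul, mul_left_comm _ c,
          RingHom.id_apply]
        exact integral_const_mul c _ }

/-- `f` is an eigenvector of the (possibly only partially defined) operator `A` for `μ`. -/
def IsEigenvector {E : Type*} [AddCommGroup E] [Module ℂ E] (A : E →ₗ.[ℂ] E) (μ : ℂ) (f : E) :
    Prop :=
  f ≠ 0 ∧ ∃ hf : f ∈ A.domain, A ⟨f, hf⟩ = μ • f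

/-- `μ` is an eigenvalue of the (possibly only partially defined) operator `A`. -/
def IsEigenvalue {E : Type*} [AddCommGroup E] [Module ℂ E] (A : E →ₗ.[ℂ] E) (μ : ℂ) : Prop :=
  ∃ f : E, IsEigenvector A μ f

/-- The classical (physicists') Hermite polynomial
`H_n(x) = (-1)ⁿ exp (x²) dⁿ/dxⁿ exp (-x²)`, as a function on `ℝ`. -/
def hermiteH (n : ℕ) (x : ℝ) : ℝ :=
  (-1) ^ n * Real.exp (x ^ 2) * iteratedDeriv n (fun y : ℝ => Real.exp (-y ^ 2)) x

/-- The integrand `H_n(x / ρ) exp (-(2 / (1 + γ)) (x - ((1 + γ) / 2) z)²)`. -/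
def integrandQ (γ : ℂ) (ρ : ℝ) (n : ℕ) (z : ℂ) (x : ℝ) : ℂ :=
  (hermiteH n (x / ρ) : ℂ) *
    Complex.exp (-(2 / (1 + γ)) * ((x : ℂ) - (1 + γ) / 2 * z) ^ 2)

/-- The Gaussian integral `Q_n(z)`. -/
def Q (γ : ℂ) (ρ : ℝ) (n : ℕ) (z : ℂ) : ℂ := ∫ x : ℝ, integrandQ γ ρ n z x

/-- The number `λ_n`. -/
def eigenval (s t γ : ℂ) (n : ℕ) : ℂ :=
  1 / csqrt s * csqrt (s / (s + (starRingEnd ℂ) t * γ)) *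
    (1 / (s + (starRingEnd ℂ) t * γ) ^ n)

/-- `γ` lies in the open unit disk and solves
`s t̄ γ² + (s² - 1 - |t|²) γ - s t = 0`. -/
def IsDiskRoot (s t γ : ℂ) : Prop :=
  ‖γ‖ < 1 ∧
    s * (starRingEnd ℂ) t * γ ^ 2 + (s ^ 2 - 1 - (‖t‖ : ℂ) ^ 2) * γ - s * t = 0

end FockIntegral

end

/-! Write `μ = s + t̄γ`. The transform sends `exp (γw²/2)` to a multiple of `exp ((t/s + γ/(sμ))
z²/2)`, so this Gaussian is an eigenfunction when `γ (sμ - 1) = tμ`, which is the quadratic equation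
for `γ`. Under `|s|² = |t|² + 1` and `|Re s| < 1` the two roots yield `μ = Re s ± i √(1 - (Re s)²)`,
both unimodular, and exactly one root lies in the disk (`exists_diskRoot`). Hence `|λ_n| = 1`.

On polynomials times `exp (γw²/2)`, integration by parts in the plane (`planeAverage_X_mul`) gives
`μ T(Xp) = z T(p) - t̄ T(p')`. For the family with generating function `exp (aXu + bu²)`,
multiplication by `X` and differentiation both stay in the family. The recursion then shows that the
`n`th member is an eigenfunction for `λ_n = λ_0 / μⁿ`, provided that `2b(μ² - 1) = a² t̄ μ`
(`transform_hermitePoly`).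

Integration by parts on the line (`gaussAverage_X_mul`) shows that Gaussian averaging preserves such
families: `H_n(x/ρ)`, with parameters `(2/ρ, -1)`, becomes up to a constant the family with `a =
(1+γ)/ρ` and `b = (1+γ)/(2ρ²) - 1` (`exists_Q_eq`). For these parameters the condition on `a, b` is
the formula for `ρ²`. -/

noncomputable section

namespace FockIntegral

open MeasureTheory Complex

/-! ### The quadratic equation and its root in the disk -/

/-- The root `γ` in the disk, with the properties of `μ = s + t̄ γ` that are needed. -/
theorem exists_diskRoot (s t : ℂ) (hst : ‖s‖ ^ 2 = ‖t‖ ^ 2 + 1) (hs : |s.re| < 1) :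
    ∃ γ : ℂ, IsDiskRoot s t γ ∧ (∀ γ' : ℂ, IsDiskRoot s t γ' → γ' = γ) ∧
      ‖s + (starRingEnd ℂ) t * γ‖ = 1 ∧
      (s + (starRingEnd ℂ) t * γ) ^ 2 - 1 ≠ 0 ∧
      γ * (s * (s + (starRingEnd ℂ) t * γ) - 1) = t * (s + (starRingEnd ℂ) t * γ) ∧
      ∃ ρ : ℝ, 0 < ρ ∧
        (ρ : ℂ) ^ 2 =
          (1 + γ) * ((s - (starRingEnd ℂ) t) * (s + (starRingEnd ℂ) t * γ) - 1) /
            (2 * ((s + (starRingEnd ℂ) t * γ) ^ 2 - 1)) := by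
  have hre : s.re ^ 2 < 1 := (sq_lt_one_iff_abs_lt_one _).2 hs
  have hs2 : s.re ^ 2 + s.im ^ 2 = t.re ^ 2 + t.im ^ 2 + 1 := by
    rw [Complex.sq_norm, Complex.sq_norm, normSq_apply, normSq_apply] at hst
    linarith
  -- `v` will be the imaginary part of `μ`. Giving it the sign of `s.im` makes `w = v + s.im`
  -- satisfy `w² - |t|² = 2vw > 0`, which puts the chosen root inside the disk and the other
  -- outside.
  obtain ⟨v, hv, hvs⟩ : ∃ v : ℝ, v ^ 2 = 1 - s.re ^ 2 ∧ 0 < v * s.im := by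
    have hpos : 0 < √(1 - s.re ^ 2) := Real.sqrt_pos.2 (by linarith)
    have hsq : √(1 - s.re ^ 2) ^ 2 = 1 - s.re ^ 2 := Real.sq_sqrt (by linarith)
    rcases lt_trichotomy s.im 0 with h | h | h
    · exact ⟨-√(1 - s.re ^ 2), by rw [neg_sq, hsq], mul_pos_of_neg_of_neg (by linarith) h⟩
    · rw [h] at hs2
      nlinarith [sq_nonneg t.re, sq_nonneg t.im]
    · exact ⟨√(1 - s.re ^ 2), hsq, mul_pos hpos h⟩
  have hv0 : v ≠ 0 := fun h => by simp [h] at hvs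
  have hw0 : v + s.im ≠ 0 := fun h => by
    have : s.im = -v := by linarith
    rw [this] at hvs
    nlinarith [sq_nonneg v]
  set w : ℝ := v + s.im with hw
  have hwC : (w : ℂ) ≠ 0 := by exact_mod_cast hw0
  have hvC : (v : ℂ) ≠ 0 := by exact_mod_cast hv0
  have hsbar : (starRingEnd ℂ) s = s.re - s.im * I := by
    apply Complex.ext <;> simp
  have hseq : s = s.re + s.im * I := (re_add_im s).symm
  have hnt : ‖t‖ ^ 2 = (s.im - v) * w := by
    rw [Complex.sq_norm, normSq_apply, hw]; linarith
  have htt : (starRingEnd ℂ) t * t = ((s.im : ℂ) - v) * w := by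
    rw [mul_comm, mul_conj, normSq_eq_norm_sq, hnt]; push_cast; ring
  have hvC2 : (v : ℂ) ^ 2 = 1 - (s.re : ℂ) ^ 2 := by exact_mod_cast hv
  -- The roots satisfy `t̄γ = -i(s.im ∓ v)`. Since `|t|² = (s.im - v)w`, dividing by `w` instead of
  -- `t̄` also covers `t = 0`.
  set γ : ℂ := t / (I * w) with hγ
  have hγt : γ * (I * w) = t := div_mul_cancel₀ _ (mul_ne_zero I_ne_zero hwC)
  clear_value w
  have hμ : s + (starRingEnd ℂ) t * γ = s.re + v * I := by
    have : (starRingEnd ℂ) t * γ = -I * (s.im - v) := by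
      rw [hγ, mul_div_assoc', htt, div_eq_iff (mul_ne_zero I_ne_zero hwC)]
      linear_combination (s.im - v : ℂ) * w * I_sq
    rw [this]; linear_combination hseq
  have hwdef : (w : ℂ) = v + s.im := by rw [hw]; push_cast; ring
  clear_value γ
  have hγ1 : ‖γ‖ < 1 := by
    have h1 : ‖γ‖ * |w| = ‖t‖ := by
      rw [← hγt]; simp
    have hwp : 0 < |w| := abs_pos.2 hw0
    have h2 : ‖t‖ ^ 2 < |w| ^ 2 := by
      rw [hnt, sq_abs, hw]
      nlinarith [sq_nonneg v, pow_pos (abs_pos.2 hv0) 2, sq_abs v]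
    have h3 : ‖t‖ < |w| := lt_of_pow_lt_pow_left₀ 2 hwp.le h2
    rw [← h1] at h3
    exact (mul_lt_iff_lt_one_left hwp).1 h3
  have hs0 : s ≠ 0 := fun h => by
    rw [h] at hst; simp at hst; nlinarith [sq_nonneg ‖t‖]
  have h1γ : 1 + γ ≠ 0 := fun h => by
    have : γ = -1 := by linear_combination h
    rw [this] at hγ1; simp at hγ1
  have hmu2 : ((s.re : ℂ) + v * I) ^ 2 - 1 = 2 * I * v * (s.re + v * I) := by
    linear_combination (-(v : ℂ) ^ 2) * I_sq + hvC2
  have hnmu : ‖(s.re : ℂ) + v * I‖ = 1 := by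
    rw [norm_add_mul_I]
    rw [hv]; simp
  have hmu0 : (s.re : ℂ) + v * I ≠ 0 := fun h => by rw [h] at hnmu; simp at hnmu
  have hmu2ne : ((s.re : ℂ) + v * I) ^ 2 - 1 ≠ 0 := by
    rw [hmu2]
    exact mul_ne_zero (mul_ne_zero (mul_ne_zero two_ne_zero I_ne_zero) hvC) hmu0
  have hroot : IsDiskRoot s t γ := by
    refine ⟨hγ1, ?_⟩
    have e1 : (starRingEnd ℂ) t * γ = s.re + v * I - s := by rw [← hμ]; ring
    have e2 : s * (s.re - s.im * I) = 1 + (‖t‖ : ℂ) ^ 2 := by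
      rw [← hsbar, mul_conj, normSq_eq_norm_sq, hst]; push_cast; ring
    linear_combination (s * γ) * e1 + γ * e2 + s * hγt - s * γ * I * hwdef
  refine ⟨γ, hroot, ?_, ?_⟩
  -- By Vieta a second root would satisfy `t̄γ' = -iw`, so `|w| ≤ |t|` if it were in the disk.
  · intro γ' h'
    by_contra hne
    have hsub : γ' - γ ≠ 0 := sub_ne_zero.2 hne
    have h1 : s * (starRingEnd ℂ) t * (γ + γ') + (s ^ 2 - 1 - (‖t‖ : ℂ) ^ 2) = 0 := by
      apply mul_left_cancel₀ hsub
      linear_combination h'.2 - hroot.2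
    have e2 : s * (s.re - s.im * I) = 1 + (‖t‖ : ℂ) ^ 2 := by
      rw [← hsbar, mul_conj, normSq_eq_norm_sq, hst]; push_cast; ring
    have h2 : (starRingEnd ℂ) t * γ' = -(I * w) := by
      apply mul_left_cancel₀ hs0
      linear_combination h1 - s * hμ - e2 + s * I * hwdef
    have h3 : ‖t‖ * ‖γ'‖ = |w| := by
      have := congrArg norm h2
      simpa using this
    have h4 : |w| ≤ ‖t‖ := by
      rw [← h3]
      exact mul_le_of_le_one_right (norm_nonneg _) h'.1.le
    have h5 : |w| ^ 2 ≤ ‖t‖ ^ 2 := pow_le_pow_left₀ (abs_nonneg _) h4 2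
    rw [hnt, sq_abs, hw] at h5
    nlinarith [sq_nonneg v, pow_pos (abs_pos.2 hv0) 2, sq_abs v]
  · rw [hμ]
    refine ⟨hnmu, hmu2ne, ?_, ?_⟩
    · have e : s * (s.re + v * I) - 1 = (s.re + v * I) * (I * w) := by
        linear_combination (s.re + v * I) * hseq + hvC2 - (s.re + v * I) * I * hwdef
          - (v : ℂ) ^ 2 * I_sq
      rw [e, ← hγt]; ring
    -- Here `u = s - t̄ - μ̄`. The bracket in the numerator is `μu`, the denominator is `4ivμ`, and
    -- `(1+γ)iw = -ū`, so the quotient is `|u|²/(4vw) > 0`.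
    · set u : ℂ := s - (starRingEnd ℂ) t - (s.re - v * I) with hu
      have hconj : (1 + γ) * (I * w) = -(starRingEnd ℂ) u := by
        have : (starRingEnd ℂ) u = (s.re - s.im * I) - t - (s.re + v * I) := by
          rw [hu]; simp only [map_sub, map_mul, conj_conj, conj_ofReal, conj_I, hsbar]; ring
        rw [this, one_add_mul, hγt, hwdef]; ring
      have hu0 : u ≠ 0 := fun h => by
        rw [h] at hconj
        simp [h1γ, hwC] at hconj
      have hvw : 0 < v * w := by
        rw [hw, mul_add]; nlinarith [sq_nonneg v]
      have hnum : (s - (starRingEnd ℂ) t) * (s.re + v * I) - 1 = (s.re + v * I) * u := by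
        rw [hu]; linear_combination hvC2 - (v : ℂ) ^ 2 * I_sq
      have hpos : 0 < ‖u‖ ^ 2 / (4 * (v * w)) := by
        have := norm_pos_iff.2 hu0
        positivity
      refine ⟨√(‖u‖ ^ 2 / (4 * (v * w))), Real.sqrt_pos.2 hpos, ?_⟩
      rw [← ofReal_pow, Real.sq_sqrt hpos.le, hnum, hmu2]
      have huu : ((‖u‖ : ℂ)) ^ 2 = -((1 + γ) * (I * w)) * u := by
        rw [hconj, neg_neg, mul_comm, mul_conj, normSq_eq_norm_sq]; push_cast; rfl
      push_cast
      rw [huu]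
      clear_value u
      rw [div_eq_div_iff (by simp [hvC, hwC]) (by simp [hvC, hmu0])]
      linear_combination (-(4 * (1 + γ) * u * v * w * (s.re + v * I))) * I_sq

/-! ### Rescaled Hermite polynomials -/

section HermitePoly

open Polynomial

/-- The rescaled Hermite polynomials with exponential generating function
`exp (a X u + b u²)`. -/
def hermitePoly {R : Type*} [CommRing R] (a b : R) : ℕ → R[X]
  | 0 => 1
  | 1 => C a * X
  | n + 2 => C a * X * hermitePoly a b (n + 1) + C (2 * b * (n + 1)) * hermitePoly a b n

variable {R : Type*} [CommRing R] (a b : R)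

/-- A uniform recursion: at `n = 0` the truncated index `n - 1` is harmless because its coefficient
vanishes. -/
theorem hermitePoly_succ (n : ℕ) :
    hermitePoly a b (n + 1) =
      C a * X * hermitePoly a b n + C (2 * b * n) * hermitePoly a b (n - 1) := by
  cases n with
  | zero => simp [hermitePoly]
  | succ n => simp [hermitePoly]

/-- Differentiating `exp (aXu + bu²)` in `X` multiplies it by `au`. -/
theorem derivative_hermitePoly (n : ℕ) :
    derivative (hermitePoly a b n) = C (a * n) * hermitePoly a b (n - 1) := by
  induction n using Nat.twoStepInduction with
  | zero => simp [hermitePoly]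
  | one => simp [hermitePoly]
  | more n h1 h2 =>
    have h3 := hermitePoly_succ a b n
    simp only [hermitePoly, derivative_add, derivative_mul, h1, h2, derivative_C, derivative_X,
      Nat.add_sub_cancel, show n + 2 - 1 = n + 1 from rfl, zero_mul, zero_add, mul_one]
    simp only [map_mul, map_add, map_one, map_natCast, map_ofNat, Nat.cast_add, Nat.cast_one,
      Nat.cast_ofNat] at h3 ⊢
    linear_combination (-(C a * (n + 1 : R[X]))) * h3

theorem degree_hermitePoly [IsDomain R] (ha : a ≠ 0) (n : ℕ) :
    (hermitePoly a b n).degree = n := by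
  induction n using Nat.twoStepInduction with
  | zero => simp [hermitePoly]
  | one => simp [hermitePoly, ha]
  | more n h1 h2 =>
    have h : (C a * X * hermitePoly a b (n + 1)).degree = ((n + 2 : ℕ) : WithBot ℕ) := by
      rw [degree_mul, degree_C_mul_X ha, h2]
      push_cast
      ring
    rw [hermitePoly, degree_add_eq_left_of_degree_lt, h]
    rw [h]
    calc (C (2 * b * (n + 1)) * hermitePoly a b n).degree
        ≤ (hermitePoly a b n).degree := by
          rw [degree_mul]
          exact add_le_of_nonpos_left degree_C_le
      _ < _ := by rw [h1]; exact_mod_cast (by omega : n < n + 2)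

theorem hermiteH_eq_eval (n : ℕ) (x : ℝ) :
    hermiteH n x = (hermitePoly (2 : ℝ) (-1) n).eval x := by
  have key : ∀ n : ℕ, iteratedDeriv n (fun y : ℝ => Real.exp (-y ^ 2)) =
      fun y => (-1) ^ n * (hermitePoly (2 : ℝ) (-1) n).eval y * Real.exp (-y ^ 2) := by
    intro n
    induction n with
    | zero => simp [hermitePoly]
    | succ n ih =>
      rw [iteratedDeriv_succ, ih]
      funext y
      have h1 : HasDerivAt (fun y : ℝ => Real.exp (-y ^ 2)) (Real.exp (-y ^ 2) * (-(2 * y))) y := by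
        simpa using ((hasDerivAt_pow 2 y).neg).exp
      have h2 := (((hermitePoly (2 : ℝ) (-1) n).hasDerivAt y).const_mul ((-1) ^ n)).mul h1
      refine h2.deriv.trans ?_
      rw [derivative_hermitePoly, hermitePoly_succ]
      simp only [eval_add, eval_mul, eval_C, eval_X]
      ring
  rw [hermiteH, key]
  have : Real.exp (x ^ 2) * Real.exp (-x ^ 2) = 1 := by rw [← Real.exp_add]; simp
  have h4 : ((-1 : ℝ) ^ n) * (-1) ^ n = 1 := by rw [← mul_pow]; simp
  linear_combination ((hermitePoly (2 : ℝ) (-1) n).eval x) * (-1) ^ n * (-1) ^ n * this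
    + ((hermitePoly (2 : ℝ) (-1) n).eval x) * h4

theorem ofReal_hermiteH_div (ρ : ℝ) (n : ℕ) (x : ℝ) :
    (hermiteH n (x / ρ) : ℂ) = (hermitePoly (2 / (ρ : ℂ)) (-1) n).eval (x : ℂ) := by
  rw [hermiteH_eq_eval]
  induction n using Nat.twoStepInduction with
  | zero => simp [hermitePoly]
  | one => simp [hermitePoly]; ring
  | more n h1 h2 =>
    simp only [hermitePoly, eval_add, eval_mul, eval_C, eval_X] at h1 h2 ⊢
    push_cast
    rw [h1, h2]
    ring

end HermitePoly

/-! ### Polynomials against Gaussians on the line -/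

/-- A polynomial is dominated by every Gaussian growth rate. -/
theorem exists_norm_eval_le (p : Polynomial ℂ) {ε : ℝ} (hε : 0 < ε) :
    ∃ K : ℝ, 0 ≤ K ∧ ∀ w : ℂ, ‖p.eval w‖ ≤ K * Real.exp (ε * ‖w‖ ^ 2) := by
  induction p using Polynomial.induction_on' generalizing ε with
  | add p q hp hq =>
    obtain ⟨K, hK, h⟩ := hp hε
    obtain ⟨L, hL, h'⟩ := hq hε
    refine ⟨K + L, add_nonneg hK hL, fun w => ?_⟩
    rw [Polynomial.eval_add, add_mul]
    exact (norm_add_le _ _).trans (add_le_add (h w) (h' w))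
  | monomial n c =>
    induction n generalizing ε with
    | zero =>
      refine ⟨‖c‖, norm_nonneg _, fun w => ?_⟩
      simp only [Polynomial.eval_monomial, pow_zero, mul_one]
      exact le_mul_of_one_le_right (norm_nonneg _) (Real.one_le_exp (by positivity))
    | succ n ih =>
      obtain ⟨K, hK, h⟩ := ih (half_pos hε)
      refine ⟨K * (1 / ε + 1), by positivity, fun w => ?_⟩
      have h1 : ‖w‖ ≤ (1 / ε + 1) * Real.exp (ε / 2 * ‖w‖ ^ 2) := by
        have h2 : ε / 2 * ‖w‖ ^ 2 + 1 ≤ Real.exp (ε / 2 * ‖w‖ ^ 2) := Real.add_one_le_exp _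
        -- The factor `1/ε + 1` makes the product contain `‖w‖²/2 + 1`, which dominates `‖w‖`.
        have h3 : ‖w‖ ≤ (1 / ε + 1) * (ε / 2 * ‖w‖ ^ 2 + 1) := by
          have : (1 / ε + 1) * (ε / 2 * ‖w‖ ^ 2 + 1) =
            ‖w‖ ^ 2 / 2 + 1 / ε + ε / 2 * ‖w‖ ^ 2 + 1 := by field_simp; ring
          rw [this]
          have : 0 < 1 / ε := by positivity
          have : 0 ≤ ε / 2 * ‖w‖ ^ 2 := by positivity
          nlinarith [sq_nonneg (‖w‖ - 1)]
        exact h3.trans (mul_le_mul_of_nonneg_left h2 (by positivity))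
      have h4 := h w
      simp only [Polynomial.eval_monomial] at h4 ⊢
      rw [pow_succ, ← mul_assoc, norm_mul]
      calc _ ≤ (K * Real.exp (ε / 2 * ‖w‖ ^ 2)) *
            ((1 / ε + 1) * Real.exp (ε / 2 * ‖w‖ ^ 2)) :=
            mul_le_mul h4 h1 (norm_nonneg _) (by positivity)
        _ = K * (1 / ε + 1) * (Real.exp (ε / 2 * ‖w‖ ^ 2) * Real.exp (ε / 2 * ‖w‖ ^ 2)) := by ring
        _ = _ := by rw [← Real.exp_add]; ring_nf

/-- Half of the Gaussian decay absorbs the polynomial; the other half keeps the integral finite. -/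
theorem integrable_eval_mul_cexp_quadratic (p : Polynomial ℂ) {b : ℂ} (hb : b.re < 0) (c d : ℂ) :
    Integrable (fun x : ℝ => p.eval (x : ℂ) * cexp (b * x ^ 2 + c * x + d)) := by
  obtain ⟨K, hK, h⟩ := exists_norm_eval_le p (ε := -b.re / 2) (by linarith)
  have hb' : (b + ((-b.re / 2 : ℝ) : ℂ)).re < 0 := by
    rw [add_re, ofReal_re]; linarith
  refine ((integrable_cexp_quadratic' hb' c d).norm.const_mul K).mono' ?_ (ae_of_all _ fun x => ?_)
  · exact (Continuous.mul (by fun_prop) (by fun_prop)).aestronglyMeasurable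
  · have e : b * (x : ℂ) ^ 2 + c * x + d + ((-b.re / 2 * x ^ 2 : ℝ) : ℂ) =
        (b + ((-b.re / 2 : ℝ) : ℂ)) * (x : ℂ) ^ 2 + c * x + d := by push_cast; ring
    rw [norm_mul, ← e, Complex.norm_exp, Complex.norm_exp, add_re _ (ofReal _), ofReal_re,
      Real.exp_add, mul_comm (Real.exp _) (Real.exp (_ * _)), ← mul_assoc]
    refine mul_le_mul_of_nonneg_right ?_ (Real.exp_pos _).le
    have := h x
    rwa [norm_real, Real.norm_eq_abs, sq_abs] at this

/-! ### Gaussian averages of Hermite polynomials -/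

section GaussianTransform

variable {γ : ℂ}

theorem one_add_ne_zero (hγ : ‖γ‖ < 1) : 1 + γ ≠ 0 := fun h => by
  have : γ = -1 := by linear_combination h
  rw [this] at hγ
  simp at hγ

theorem re_one_add_pos (hγ : ‖γ‖ < 1) : 0 < (1 + γ).re := by
  have := (abs_lt.1 ((abs_re_le_norm γ).trans_lt hγ)).1
  simp only [add_re, one_re]
  linarith

theorem re_two_div_one_add_pos (hγ : ‖γ‖ < 1) : 0 < (2 / (1 + γ)).re := by
  rw [div_eq_mul_inv, inv_def, ← mul_assoc, re_mul_ofReal]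
  have h1 := re_one_add_pos hγ
  have h2 := normSq_pos.2 (one_add_ne_zero hγ)
  have : (2 * (starRingEnd ℂ) (1 + γ)).re = 2 * (1 + γ).re := by
    simp [-map_add]
  rw [this]
  positivity

theorem neg_two_div_mul_sq (hγ : ‖γ‖ < 1) (z : ℂ) (x : ℂ) :
    -(2 / (1 + γ)) * (x - (1 + γ) / 2 * z) ^ 2 =
      -(2 / (1 + γ)) * x ^ 2 + 2 * z * x + -((1 + γ) / 2 * z ^ 2) := by
  have := one_add_ne_zero hγ
  field_simp
  ring

/-- The Gaussian average of a polynomial whose values at Hermite polynomials are the `Q_n`. -/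
def gaussAverage (γ : ℂ) (p : Polynomial ℂ) (z : ℂ) : ℂ :=
  ∫ x : ℝ, p.eval (x : ℂ) * cexp (-(2 / (1 + γ)) * ((x : ℂ) - (1 + γ) / 2 * z) ^ 2)

theorem integrable_gaussAverage (hγ : ‖γ‖ < 1) (p : Polynomial ℂ) (z : ℂ) :
    Integrable (fun x : ℝ =>
      p.eval (x : ℂ) * cexp (-(2 / (1 + γ)) * ((x : ℂ) - (1 + γ) / 2 * z) ^ 2)) := by
  simp_rw [neg_two_div_mul_sq hγ]
  refine integrable_eval_mul_cexp_quadratic p ?_ _ _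
  rw [neg_re]
  linarith [re_two_div_one_add_pos hγ]

theorem gaussAverage_add (hγ : ‖γ‖ < 1) (p q : Polynomial ℂ) (z : ℂ) :
    gaussAverage γ (p + q) z = gaussAverage γ p z + gaussAverage γ q z := by
  simp only [gaussAverage, Polynomial.eval_add, add_mul]
  exact integral_add (integrable_gaussAverage hγ p z) (integrable_gaussAverage hγ q z)

theorem gaussAverage_C_mul (γ c : ℂ) (p : Polynomial ℂ) (z : ℂ) :
    gaussAverage γ (Polynomial.C c * p) z = c * gaussAverage γ p z := by
  simp only [gaussAverage, Polynomial.eval_mul, Polynomial.eval_C, mul_assoc]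
  exact integral_const_mul c _

/-- The integral of the derivative of `p` times the Gaussian vanishes, and the exponent has
derivative `-(4/(1+γ))x + 2z`. -/
theorem gaussAverage_X_mul (hγ : ‖γ‖ < 1) (p : Polynomial ℂ) (z : ℂ) :
    gaussAverage γ (Polynomial.X * p) z =
      (1 + γ) / 2 * z * gaussAverage γ p z +
        (1 + γ) / 4 * gaussAverage γ (Polynomial.derivative p) z := by
  have h0 := one_add_ne_zero hγ
  have hd : ∀ x : ℝ, HasDerivAt (fun x : ℝ => p.eval (x : ℂ) *
      cexp (-(2 / (1 + γ)) * ((x : ℂ) - (1 + γ) / 2 * z) ^ 2))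
      ((Polynomial.derivative p + Polynomial.C (-(4 / (1 + γ))) * (Polynomial.X * p) +
        Polynomial.C (2 * z) * p).eval (x : ℂ) *
        cexp (-(2 / (1 + γ)) * ((x : ℂ) - (1 + γ) / 2 * z) ^ 2)) x := by
    intro x
    have h1 : HasDerivAt (fun w : ℂ => -(2 / (1 + γ)) * (w - (1 + γ) / 2 * z) ^ 2)
        (-(2 / (1 + γ)) * (2 * ((x : ℂ) - (1 + γ) / 2 * z))) (x : ℂ) := by
      simpa using ((((hasDerivAt_id (x : ℂ)).sub_const ((1 + γ) / 2 * z)).pow 2).const_mul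
        (-(2 / (1 + γ))))
    convert! ((p.hasDerivAt (x : ℂ)).mul h1.cexp).comp_ofReal using 1
    simp only [Polynomial.eval_add, Polynomial.eval_mul, Polynomial.eval_C, Polynomial.eval_X]
    field_simp
    ring
  have := integral_eq_zero_of_hasDerivAt_of_integrable hd (integrable_gaussAverage hγ _ z)
    (integrable_gaussAverage hγ _ z)
  change gaussAverage γ _ z = 0 at this
  rw [gaussAverage_add hγ, gaussAverage_add hγ, gaussAverage_C_mul, gaussAverage_C_mul] at this
  field_simp at this
  linear_combination (-1 / 4) * this

theorem gaussAverage_one_ne_zero (hγ : ‖γ‖ < 1) :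
    ∃ c : ℂ, c ≠ 0 ∧ ∀ z, gaussAverage γ 1 z = c := by
  have h0 := one_add_ne_zero hγ
  refine ⟨(Real.pi / - -(2 / (1 + γ))) ^ (1 / 2 : ℂ), ?_, fun z => ?_⟩
  · rw [neg_neg, Ne, cpow_eq_zero_iff]
    simp [h0, Real.pi_ne_zero]
  · simp only [gaussAverage, Polynomial.eval_one, one_mul]
    simp_rw [neg_two_div_mul_sq hγ]
    rw [integral_cexp_quadratic (by rw [neg_re]; linarith [re_two_div_one_add_pos hγ])]
    convert mul_one _
    rw [Complex.exp_eq_one_iff]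
    refine ⟨0, ?_⟩
    field_simp
    ring

theorem integrandQ_eq (γ : ℂ) (ρ : ℝ) (n : ℕ) (z : ℂ) (x : ℝ) :
    integrandQ γ ρ n z x = (hermitePoly (2 / (ρ : ℂ)) (-1) n).eval (x : ℂ) *
      cexp (-(2 / (1 + γ)) * ((x : ℂ) - (1 + γ) / 2 * z) ^ 2) := by
  rw [integrandQ, ofReal_hermiteH_div]

theorem Q_eq_gaussAverage (γ : ℂ) (ρ : ℝ) (n : ℕ) (z : ℂ) :
    Q γ ρ n z = gaussAverage γ (hermitePoly (2 / (ρ : ℂ)) (-1) n) z := by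
  simp only [Q, integrandQ_eq, gaussAverage]

theorem integrable_integrandQ (hγ : ‖γ‖ < 1) (ρ : ℝ) (n : ℕ) (z : ℂ) :
    Integrable (integrandQ γ ρ n z) := by
  simpa only [← integrandQ_eq] using
    integrable_gaussAverage hγ (hermitePoly (2 / (ρ : ℂ)) (-1) n) z

/-- `Q_n` is a nonzero multiple of a rescaled Hermite polynomial. -/
theorem exists_Q_eq (hγ : ‖γ‖ < 1) {ρ : ℝ} (hρ : ρ ≠ 0) :
    ∃ c : ℂ, c ≠ 0 ∧ ∀ n z, Q γ ρ n z =
      c * (hermitePoly ((1 + γ) / ρ) ((1 + γ) / (2 * ρ ^ 2) - 1) n).eval z := by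
  have hρ' : (ρ : ℂ) ≠ 0 := by exact_mod_cast hρ
  obtain ⟨c, hc, h⟩ := gaussAverage_one_ne_zero hγ
  -- Averaging turns `X` into `(1+γ)/2 · z + (1+γ)/4 · d/dX`. Since the derivative of the `n`th
  -- polynomial is `2n/ρ` times its predecessor, `b = -1` is shifted by `(1+γ)/(2ρ²)`.
  have step : ∀ n z, Q γ ρ (n + 1) z = (1 + γ) / ρ * z * Q γ ρ n z +
      2 * ((1 + γ) / (2 * ρ ^ 2) - 1) * n * Q γ ρ (n - 1) z := by
    intro n z
    rw [Q_eq_gaussAverage, hermitePoly_succ, gaussAverage_add hγ, mul_assoc, gaussAverage_C_mul,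
      gaussAverage_C_mul, gaussAverage_X_mul hγ, derivative_hermitePoly, gaussAverage_C_mul,
      ← Q_eq_gaussAverage, ← Q_eq_gaussAverage]
    field_simp
    ring
  have h0 : ∀ z, Q γ ρ 0 z = c := fun z => by rw [Q_eq_gaussAverage, hermitePoly, h]
  refine ⟨c, hc, fun n z => ?_⟩
  induction n using Nat.twoStepInduction with
  | zero => simp [h0, hermitePoly]
  | one => rw [step]; simp [h0, hermitePoly]; ring
  | more n h1 h2 =>
    rw [step, h2, Nat.add_sub_cancel, h1, hermitePoly_succ _ _ (n + 1)]
    simp only [Polynomial.eval_add, Polynomial.eval_mul, Polynomial.eval_C, Polynomial.eval_X,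
      Nat.add_sub_cancel]
    ring

end GaussianTransform

/-! ### The principal square root -/

section SquareRoot

theorem csqrt_eq_cpow {z : ℂ} (hz : z ≠ 0) : csqrt z = z ^ (1 / 2 : ℂ) := by
  have h : Real.sqrt ‖z‖ = Real.exp (Real.log ‖z‖ / 2) := by
    rw [Real.exp_half, Real.exp_log (norm_pos_iff.2 hz)]
  rw [csqrt, h, ofReal_exp, ← Complex.exp_add, cpow_def_of_ne_zero hz, log]
  congr 1
  push_cast
  ring

theorem norm_csqrt (z : ℂ) : ‖csqrt z‖ = Real.sqrt ‖z‖ := by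
  have : I * (z.arg : ℂ) / 2 = ((z.arg / 2 : ℝ) : ℂ) * I := by push_cast; ring
  rw [csqrt, norm_mul, this, norm_exp_ofReal_mul_I, norm_real, mul_one,
    Real.norm_of_nonneg (Real.sqrt_nonneg _)]

theorem csqrt_ofReal_sq {r : ℝ} (hr : 0 ≤ r) : csqrt ((r ^ 2 : ℝ) : ℂ) = r := by
  rw [csqrt, arg_ofReal_of_nonneg (sq_nonneg r), norm_real, Real.norm_of_nonneg (sq_nonneg r),
    Real.sqrt_sq hr]
  simp

/-- Both arguments lie in `(-π/2, π/2)`, so their sum stays within the principal range. -/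
theorem csqrt_mul_of_re_pos {x y : ℂ} (hx : 0 < x.re) (hy : 0 < y.re) :
    csqrt (x * y) = csqrt x * csqrt y := by
  have hx0 : x ≠ 0 := fun h => by simp [h] at hx
  have hy0 : y ≠ 0 := fun h => by simp [h] at hy
  have h1 := abs_lt.1 (abs_arg_lt_pi_div_two_iff.2 (Or.inl hx))
  have h2 := abs_lt.1 (abs_arg_lt_pi_div_two_iff.2 (Or.inl hy))
  rw [csqrt, csqrt, csqrt, arg_mul hx0 hy0 ⟨by linarith, by linarith⟩, norm_mul,
    Real.sqrt_mul (norm_nonneg _), mul_mul_mul_comm, ← Complex.exp_add]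
  push_cast
  congr 2
  ring

theorem re_div_pos {x y : ℂ} (h : 0 < (x * (starRingEnd ℂ) y).re) : 0 < (x / y).re := by
  have hy : y ≠ 0 := fun h' => by simp [h'] at h
  rw [div_eq_mul_inv, inv_def, ← mul_assoc, re_mul_ofReal]
  have := normSq_pos.2 hy
  positivity

end SquareRoot

/-! ### Gaussian integrals on the plane -/

section PlaneGaussian

variable {α β : ℂ}

/-- The exponent of a Gaussian on the plane. -/
def phase (α β c w : ℂ) : ℂ :=
  α * w ^ 2 / 2 + β * (starRingEnd ℂ) w ^ 2 / 2 + c * (starRingEnd ℂ) w - w * (starRingEnd ℂ) w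

theorem norm_cexp_phase_le (hα : ‖α‖ < 1) (hβ : ‖β‖ < 1) (c : ℂ) :
    ∃ K δ : ℝ, 0 ≤ K ∧ 0 < δ ∧ ∀ w, ‖cexp (phase α β c w)‖ ≤ K * Real.exp (-δ * ‖w‖ ^ 2) := by
  -- The quadratic part decays at rate `2δ`; one `δ` is spent on the linear term by completing the
  -- square.
  set δ : ℝ := (1 - (‖α‖ + ‖β‖) / 2) / 2 with hδ
  have hδ0 : 0 < δ := by rw [hδ]; linarith
  refine ⟨Real.exp (‖c‖ ^ 2 / (4 * δ)), δ, (Real.exp_pos _).le, hδ0, fun w => ?_⟩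
  rw [Complex.norm_exp, ← Real.exp_add, Real.exp_le_exp]
  have h1 : (phase α β c w).re = (α * w ^ 2 / 2 + β * (starRingEnd ℂ) w ^ 2 / 2 +
      c * (starRingEnd ℂ) w).re - ‖w‖ ^ 2 := by
    rw [phase, sub_re, mul_conj, ofReal_re, normSq_eq_norm_sq]
  have h2 : (α * w ^ 2 / 2 + β * (starRingEnd ℂ) w ^ 2 / 2 + c * (starRingEnd ℂ) w).re ≤
      ‖α‖ * ‖w‖ ^ 2 / 2 + ‖β‖ * ‖w‖ ^ 2 / 2 + ‖c‖ * ‖w‖ := by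
    refine (re_le_norm _).trans ((norm_add_le _ _).trans ?_)
    refine add_le_add ((norm_add_le _ _).trans (add_le_add ?_ ?_)) ?_ <;> simp
  have h3 : ‖c‖ * ‖w‖ ≤ ‖c‖ ^ 2 / (4 * δ) + δ * ‖w‖ ^ 2 := by
    have : ‖c‖ ^ 2 / (4 * δ) + δ * ‖w‖ ^ 2 - ‖c‖ * ‖w‖ =
        (‖c‖ - 2 * δ * ‖w‖) ^ 2 / (4 * δ) := by field_simp; ring
    have h4 : 0 ≤ (‖c‖ - 2 * δ * ‖w‖) ^ 2 / (4 * δ) := by positivity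
    linarith
  have h5 : ‖α‖ * ‖w‖ ^ 2 / 2 + ‖β‖ * ‖w‖ ^ 2 / 2 = (1 - 2 * δ) * ‖w‖ ^ 2 := by rw [hδ]; ring
  rw [h1]
  linarith

theorem continuous_phase (α β c : ℂ) : Continuous (phase α β c) := by
  unfold phase
  fun_prop

theorem integrable_exp_neg_mul_norm_sq {δ : ℝ} (hδ : 0 < δ) :
    Integrable (fun w : ℂ => Real.exp (-δ * ‖w‖ ^ 2)) := by
  have := (GaussianFourier.integrable_cexp_neg_mul_sq_norm_add (V := ℂ) (b := (δ : ℂ))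
    (by simpa using hδ) 0 0).norm
  refine this.congr (ae_of_all _ fun w => ?_)
  simp only [Complex.norm_exp, zero_mul, add_zero]
  rw [← ofReal_pow, ← ofReal_neg, ← ofReal_mul, ofReal_re]

theorem integrable_eval_mul_cexp_phase (hα : ‖α‖ < 1) (hβ : ‖β‖ < 1) (c : ℂ) (p : Polynomial ℂ) :
    Integrable (fun w : ℂ => p.eval w * cexp (phase α β c w)) := by
  obtain ⟨K, δ, hK, hδ, h⟩ := norm_cexp_phase_le hα hβ c
  obtain ⟨L, hL, h'⟩ := exists_norm_eval_le p (half_pos hδ)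
  refine ((integrable_exp_neg_mul_norm_sq (half_pos hδ)).const_mul (L * K)).mono' ?_
    (ae_of_all _ fun w => ?_)
  · exact (Continuous.mul (by fun_prop) (continuous_phase α β c).cexp).aestronglyMeasurable
  · rw [norm_mul]
    refine (mul_le_mul (h' w) (h w) (norm_nonneg _) (by positivity)).trans (le_of_eq ?_)
    rw [mul_mul_mul_comm, ← Real.exp_add]
    ring_nf

theorem integrable_conj_mul_eval_mul_cexp_phase (hα : ‖α‖ < 1) (hβ : ‖β‖ < 1) (c : ℂ)
    (p : Polynomial ℂ) :
    Integrable (fun w : ℂ => (starRingEnd ℂ) w * (p.eval w * cexp (phase α β c w))) := by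
  refine (integrable_eval_mul_cexp_phase hα hβ c (Polynomial.X * p)).mono ?_
    (ae_of_all _ fun w => ?_)
  · exact (Continuous.mul (by fun_prop)
      (Continuous.mul (by fun_prop) (continuous_phase α β c).cexp)).aestronglyMeasurable
  · simp [mul_assoc]

/-- The integral of a polynomial against a Gaussian on the plane. -/
def planeAverage (α β c : ℂ) (p : Polynomial ℂ) : ℂ :=
  ∫ w : ℂ, p.eval w * cexp (phase α β c w)

theorem planeAverage_add (hα : ‖α‖ < 1) (hβ : ‖β‖ < 1) (c : ℂ) (p q : Polynomial ℂ) :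
    planeAverage α β c (p + q) = planeAverage α β c p + planeAverage α β c q := by
  simp only [planeAverage, Polynomial.eval_add, add_mul]
  exact integral_add (integrable_eval_mul_cexp_phase hα hβ c p)
    (integrable_eval_mul_cexp_phase hα hβ c q)

theorem planeAverage_C_mul (α β c d : ℂ) (p : Polynomial ℂ) :
    planeAverage α β c (Polynomial.C d * p) = d * planeAverage α β c p := by
  simp only [planeAverage, Polynomial.eval_mul, Polynomial.eval_C, mul_assoc]
  exact integral_const_mul d _

/-- The integral of the derivative of a Gaussian on the plane in the direction `v` vanishes. -/
theorem planeAverage_lineDeriv (hα : ‖α‖ < 1) (hβ : ‖β‖ < 1) (c v : ℂ) (p : Polynomial ℂ) :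
    v * planeAverage α β c (Polynomial.derivative p) +
      (α * v - (starRingEnd ℂ) v) * planeAverage α β c (Polynomial.X * p) +
      c * (starRingEnd ℂ) v * planeAverage α β c p +
      (β * (starRingEnd ℂ) v - v) *
        ∫ w : ℂ, (starRingEnd ℂ) w * (p.eval w * cexp (phase α β c w)) = 0 := by
  set q : Polynomial ℂ := Polynomial.C v * Polynomial.derivative p +
    Polynomial.C (α * v - (starRingEnd ℂ) v) * (Polynomial.X * p) +
    Polynomial.C (c * (starRingEnd ℂ) v) * p with hq
  have i1 := integrable_eval_mul_cexp_phase hα hβ c q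
  have i2 := (integrable_conj_mul_eval_mul_cexp_phase hα hβ c p).const_mul
    (β * (starRingEnd ℂ) v - v)
  have hd : ∀ w : ℂ, HasLineDerivAt ℝ (fun w => p.eval w * cexp (phase α β c w))
      (q.eval w * cexp (phase α β c w) + (β * (starRingEnd ℂ) v - v) *
        ((starRingEnd ℂ) w * (p.eval w * cexp (phase α β c w)))) w v := by
    intro w
    have h1 : HasDerivAt (fun τ : ℂ => w + τ * v) v ((0 : ℝ) : ℂ) := by
      simpa using ((hasDerivAt_id ((0 : ℝ) : ℂ)).mul_const v).const_add w
    have h2 : HasDerivAt (fun τ : ℂ => (starRingEnd ℂ) w + τ * (starRingEnd ℂ) v)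
        ((starRingEnd ℂ) v) ((0 : ℝ) : ℂ) := by
      simpa using ((hasDerivAt_id ((0 : ℝ) : ℂ)).mul_const
        ((starRingEnd ℂ) v)).const_add ((starRingEnd ℂ) w)
    have h3 := (((((h1.fun_pow 2).const_mul α).div_const 2).fun_add
      (((h2.fun_pow 2).const_mul β).div_const 2)).fun_add (h2.const_mul c)).fun_sub
        (h1.fun_mul h2)
    have h4 : HasDerivAt (fun τ : ℂ => p.eval (w + τ * v)) _ ((0 : ℝ) : ℂ) :=
      (p.hasDerivAt _).comp _ h1
    have h5 := (h4.fun_mul h3.cexp).comp_ofReal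
    unfold HasLineDerivAt
    convert! h5 using 1
    · funext τ
      simp [phase]
    · simp [hq, phase]
      ring
  have key := integral_bilinear_hasLineDerivAt_right_eq_neg_left_of_integrable
    (μ := (volume : Measure ℂ)) (B := ContinuousLinearMap.mul ℝ ℂ)
    (f := fun _ => (1 : ℂ)) (f' := fun _ => 0) (v := v)
    (g := fun w => p.eval w * cexp (phase α β c w))
    (g' := fun w => q.eval w * cexp (phase α β c w) + (β * (starRingEnd ℂ) v - v) *
        ((starRingEnd ℂ) w * (p.eval w * cexp (phase α β c w))))
    (by simp) (by simp only [ContinuousLinearMap.mul_apply', one_mul]; exact i1.add i2)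
    (by simpa using integrable_eval_mul_cexp_phase hα hβ c p)
    (fun _ _ => by unfold HasLineDerivAt; exact hasDerivAt_const _ _)
    (fun w _ => hd w)
  simp only [ContinuousLinearMap.mul_apply', one_mul, zero_mul, integral_zero, neg_zero] at key
  rw [integral_add i1 i2, integral_const_mul] at key
  change planeAverage α β c q + _ = 0 at key
  rwa [hq, planeAverage_add hα hβ, planeAverage_add hα hβ, planeAverage_C_mul,
    planeAverage_C_mul, planeAverage_C_mul] at key

/-- The derivatives along `1` and `I` give two relations, from which the integral containing `w̄` is
eliminated. -/
theorem planeAverage_X_mul (hα : ‖α‖ < 1) (hβ : ‖β‖ < 1) (c : ℂ) (p : Polynomial ℂ) :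
    (1 - α * β) * planeAverage α β c (Polynomial.X * p) =
      c * planeAverage α β c p + β * planeAverage α β c (Polynomial.derivative p) := by
  have h1 := planeAverage_lineDeriv hα hβ c 1 p
  have h2 := planeAverage_lineDeriv hα hβ c I p
  rw [map_one] at h1
  rw [conj_I] at h2
  set R := ∫ w : ℂ, (starRingEnd ℂ) w * (p.eval w * cexp (phase α β c w))
  have h2' : planeAverage α β c (Polynomial.derivative p) +
      (α + 1) * planeAverage α β c (Polynomial.X * p) - c * planeAverage α β c p -
      (β + 1) * R = 0 := by
    apply mul_left_cancel₀ I_ne_zero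
    linear_combination h2
  linear_combination (-(1 + β) / 2) * h1 + ((1 - β) / 2) * h2'

/-- With `a = |α|` and `b = |β|`, replacing `Re α`, `Re β`, `Re (αβ)` by `-a`, `-b`, `ab` bounds the
real part below by `(1 - ab)(2 - a - b)/2`. This places `D / A` in the right half-plane in
`planeAverage_one`. -/
theorem re_one_sub_mul_mul_conj_pos (hα : ‖α‖ < 1) (hβ : ‖β‖ < 1) :
    0 < ((1 - α * β) * (starRingEnd ℂ) (1 + (α + β) / 2)).re := by
  have e : (1 - α * β) * (starRingEnd ℂ) (1 + (α + β) / 2) =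
      1 - (α * β + (((‖β‖ ^ 2 : ℝ) : ℂ) * α - (starRingEnd ℂ) α) / 2 +
        (((‖α‖ ^ 2 : ℝ) : ℂ) * β - (starRingEnd ℂ) β) / 2) := by
    rw [← normSq_eq_norm_sq, ← normSq_eq_norm_sq, ← mul_conj, ← mul_conj]
    simp only [map_add, map_one, map_div₀, map_ofNat]
    ring
  rw [e, sub_re, one_re, add_re, add_re, div_ofNat_re, div_ofNat_re, sub_re, sub_re, re_ofReal_mul,
    re_ofReal_mul, conj_re, conj_re]
  have h1 : (α * β).re ≤ ‖α‖ * ‖β‖ := (re_le_norm _).trans (norm_mul _ _).le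
  have h2 := (abs_le.1 (abs_re_le_norm α)).1
  have h3 := (abs_le.1 (abs_re_le_norm β)).1
  have ha := norm_nonneg α
  have hb := norm_nonneg β
  have h4 : 0 ≤ (α.re + ‖α‖) * (1 - ‖β‖ ^ 2) :=
    mul_nonneg (by linarith) (by nlinarith)
  have h5 : 0 ≤ (β.re + ‖β‖) * (1 - ‖α‖ ^ 2) :=
    mul_nonneg (by linarith) (by nlinarith)
  have h6 : 0 < (1 - ‖α‖ * ‖β‖) * (2 - ‖α‖ - ‖β‖) :=
    mul_pos (by nlinarith) (by linarith)
  nlinarith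

theorem re_one_sub_mul_pos (hα : ‖α‖ < 1) (hβ : ‖β‖ < 1) : 0 < (1 - α * β).re := by
  have h1 : (α * β).re ≤ ‖α‖ * ‖β‖ := (re_le_norm _).trans (norm_mul _ _).le
  rw [sub_re, one_re]
  nlinarith [norm_nonneg α, norm_nonneg β]

theorem planeAverage_one (hα : ‖α‖ < 1) (hβ : ‖β‖ < 1) (c : ℂ) :
    planeAverage α β c 1 =
      Real.pi * csqrt (1 / (1 - α * β)) * cexp (α * c ^ 2 / (2 * (1 - α * β))) := by
  set A : ℂ := 1 + (α + β) / 2 with hA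
  set D : ℂ := 1 - α * β with hD
  have hAre : 0 < A.re := by
    apply re_one_add_pos
    rw [norm_div, Complex.norm_ofNat]
    linarith [norm_add_le α β]
  have hDre : 0 < D.re := re_one_sub_mul_pos hα hβ
  have hBre : 0 < (D / A).re := re_div_pos (re_one_sub_mul_mul_conj_pos hα hβ)
  have hA0 : A ≠ 0 := fun h => by simp [h] at hAre
  have hD0 : D ≠ 0 := fun h => by simp [h] at hDre
  have hpi : (Real.pi : ℂ) ≠ 0 := by exact_mod_cast Real.pi_ne_zero
  have hint := integrable_eval_mul_cexp_phase hα hβ c 1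
  have hmp := volume_preserving_equiv_real_prod.symm
  rw [← hmp.integrable_comp_emb measurableEquivRealProd.symm.measurableEmbedding] at hint
  rw [planeAverage, ← hmp.integral_comp measurableEquivRealProd.symm.measurableEmbedding]
  have hint' : Integrable (Function.uncurry fun x y : ℝ => cexp (-A * (y : ℂ) ^ 2 +
      (I * ((α - β) * x - c)) * y + (-(2 - A) * x ^ 2 + c * x))) (volume.prod volume) := by
    refine hint.congr (ae_of_all _ fun q => ?_)
    simp only [Function.comp, measurableEquivRealProd_symm_apply, Polynomial.eval_one, one_mul,
      Function.uncurry, mk_eq_add_mul_I, phase, map_add, map_mul, conj_ofReal, conj_I, hA]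
    congr 1
    linear_combination ((α + β) / 2 * (q.2 : ℂ) ^ 2 + (q.2 : ℂ) ^ 2) * I_sq
  have hcongr : ∫ q : ℝ × ℝ, (Polynomial.eval (measurableEquivRealProd.symm q) 1 *
      cexp (phase α β c (measurableEquivRealProd.symm q))) =
      ∫ q : ℝ × ℝ, Function.uncurry (fun x y : ℝ => cexp (-A * (y : ℂ) ^ 2 +
      (I * ((α - β) * x - c)) * y + (-(2 - A) * x ^ 2 + c * x))) q := by
    congr 1
    funext q
    simp only [measurableEquivRealProd_symm_apply, Polynomial.eval_one, one_mul,
      Function.uncurry, mk_eq_add_mul_I, phase, map_add, map_mul, conj_ofReal, conj_I, hA]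
    congr 1
    linear_combination ((α + β) / 2 * (q.2 : ℂ) ^ 2 + (q.2 : ℂ) ^ 2) * I_sq
  rw [hcongr, Measure.volume_eq_prod, integral_prod _ hint']
  simp only [Function.uncurry]
  have inner : ∀ x : ℝ, ∫ y : ℝ, cexp (-A * (y : ℂ) ^ 2 +
      (I * ((α - β) * x - c)) * y + (-(2 - A) * x ^ 2 + c * x)) =
      (Real.pi / A) ^ (1 / 2 : ℂ) * cexp (-(D / A) * (x : ℂ) ^ 2 +
        (c * (1 + α) / A) * x + -(c ^ 2 / (4 * A))) := by
    -- The integral over `y` leaves a Gaussian in `x` with rate `D / A`.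
    intro x
    rw [integral_cexp_quadratic (by rw [neg_re]; linarith), neg_neg]
    congr 2
    field_simp
    rw [hA, hD, I_sq]
    ring
  simp_rw [inner]
  rw [integral_const_mul, integral_cexp_quadratic (by rw [neg_re]; linarith), neg_neg, ← mul_assoc]
  congr 1
  -- All factors lie in the right half-plane, so the two roots multiply to the principal root of
  -- `π²/D` with no sign ambiguity.
  · have h1 : 0 < (Real.pi / A : ℂ).re := by
      apply re_div_pos
      rw [re_ofReal_mul, conj_re]
      exact mul_pos Real.pi_pos hAre
    have h2 : 0 < (Real.pi / (D / A) : ℂ).re := by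
      apply re_div_pos
      rw [re_ofReal_mul, conj_re]
      exact mul_pos Real.pi_pos hBre
    have h3 : 0 < (1 / D : ℂ).re := by
      apply re_div_pos
      simpa using hDre
    have h4 : 0 < (((Real.pi ^ 2 : ℝ) : ℂ)).re := by
      rw [ofReal_re]; positivity
    rw [← csqrt_eq_cpow (div_ne_zero hpi hA0),
      ← csqrt_eq_cpow (div_ne_zero hpi (div_ne_zero hD0 hA0)), ← csqrt_mul_of_re_pos h1 h2,
      ← csqrt_ofReal_sq Real.pi_pos.le, ← csqrt_mul_of_re_pos h4 h3,
      csqrt_ofReal_sq Real.pi_pos.le]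
    congr 1
    push_cast
    field_simp
  · congr 1
    field_simp
    rw [hA, hD]
    ring

end PlaneGaussian

/-! ### The Gaussian measure and membership in the Fock space -/

section FockSpace

theorem measurable_gaussianDensity :
    Measurable fun z : ℂ => ENNReal.ofReal (Real.pi⁻¹ * Real.exp (-‖z‖ ^ 2)) := by
  fun_prop

variable {E : Type*} [NormedAddCommGroup E] [NormedSpace ℝ E]

theorem integrable_gaussian_iff {f : ℂ → E} :
    Integrable f gaussian ↔ Integrable (fun w => (Real.pi⁻¹ * Real.exp (-‖w‖ ^ 2)) • f w) := by
  rw [gaussian, integrable_withDensity_iff_integrable_smul' measurable_gaussianDensity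
    (ae_of_all _ fun _ => ENNReal.ofReal_lt_top)]
  refine integrable_congr (ae_of_all _ fun w => ?_)
  simp only
  rw [ENNReal.toReal_ofReal (by positivity)]

theorem integral_gaussian (f : ℂ → E) :
    ∫ w, f w ∂gaussian = ∫ w, (Real.pi⁻¹ * Real.exp (-‖w‖ ^ 2)) • f w := by
  rw [gaussian, integral_withDensity_eq_integral_toReal_smul measurable_gaussianDensity
    (ae_of_all _ fun _ => ENNReal.ofReal_lt_top)]
  refine integral_congr_ae (ae_of_all _ fun w => ?_)
  simp only
  rw [ENNReal.toReal_ofReal (by positivity)]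

/-- The squared modulus times `exp (-|z|²)` is the modulus of `p² exp (phase γ γ̄ 0)`, an integrable
plane Gaussian. -/
theorem eval_mul_cexp_mem_Fock {γ : ℂ} (hγ : ‖γ‖ < 1) (p : Polynomial ℂ) :
    (fun z => p.eval z * cexp (γ * z ^ 2 / 2)) ∈ Fock := by
  have hc : Continuous fun z : ℂ => p.eval z * cexp (γ * z ^ 2 / 2) := by fun_prop
  refine ⟨by fun_prop, ?_⟩
  rw [memLp_two_iff_integrable_sq_norm hc.aestronglyMeasurable]
  refine integrable_gaussian_iff.2 ?_
  have hγ' : ‖(starRingEnd ℂ) γ‖ < 1 := by simpa using hγ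
  have := ((integrable_eval_mul_cexp_phase hγ hγ' 0 (p * p)).norm.const_mul
    Real.pi⁻¹)
  refine this.congr (ae_of_all _ fun w => ?_)
  have e : (phase γ ((starRingEnd ℂ) γ) 0 w).re =
      -‖w‖ ^ 2 + ((γ * w ^ 2 / 2).re + (γ * w ^ 2 / 2).re) := by
    have : phase γ ((starRingEnd ℂ) γ) 0 w = γ * w ^ 2 / 2 +
        (starRingEnd ℂ) (γ * w ^ 2 / 2) - ((‖w‖ ^ 2 : ℝ) : ℂ) := by
      rw [← normSq_eq_norm_sq, ← mul_conj, phase]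
      simp only [map_div₀, map_mul, map_pow, map_ofNat]
      ring
    rw [this, sub_re, add_re, conj_re, ofReal_re]
    ring
  simp only [Polynomial.eval_mul, norm_mul, Complex.norm_exp, e, Real.exp_add]
  rw [smul_eq_mul]
  ring

end FockSpace

/-! ### Action of the transform on polynomials times a Gaussian -/

section Transform

variable {s t γ : ℂ}

/-- The integrand of the transform is a Gaussian on the plane. -/
theorem gaussianDensity_smul_kernel_mul (hs : s ≠ 0) (p : Polynomial ℂ) (z w : ℂ) :
    (Real.pi⁻¹ * Real.exp (-‖w‖ ^ 2)) • (kernel s t z w * (p.eval w * cexp (γ * w ^ 2 / 2))) =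
    (1 / csqrt s * (Real.pi : ℂ)⁻¹ * cexp (t * z ^ 2 / (2 * s))) *
      (p.eval w * cexp (phase γ (-(starRingEnd ℂ) t / s) (z / s) w)) := by
  have e : cexp (-((‖w‖ ^ 2 : ℝ) : ℂ)) * cexp ((t * z ^ 2 - (starRingEnd ℂ) (t * w ^ 2) +
      2 * z * (starRingEnd ℂ) w) / (2 * s)) * cexp (γ * w ^ 2 / 2) =
      cexp (t * z ^ 2 / (2 * s)) *
        cexp (phase γ (-(starRingEnd ℂ) t / s) (z / s) w) := by
    rw [← Complex.exp_add, ← Complex.exp_add, ← Complex.exp_add, ← normSq_eq_norm_sq, ← mul_conj,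
      phase]
    congr 1
    simp only [map_mul, map_pow]
    field_simp
    ring
  rw [kernel, real_smul]
  push_cast at e ⊢
  linear_combination (1 / csqrt s * (Real.pi : ℂ)⁻¹ * p.eval w) * e

theorem integrable_kernel_mul (hs : s ≠ 0) (hγ : ‖γ‖ < 1) (hβ : ‖-(starRingEnd ℂ) t / s‖ < 1)
    (p : Polynomial ℂ) (z : ℂ) :
    Integrable (fun w => kernel s t z w * (p.eval w * cexp (γ * w ^ 2 / 2))) gaussian := by
  rw [integrable_gaussian_iff]
  simp_rw [gaussianDensity_smul_kernel_mul hs]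
  exact (integrable_eval_mul_cexp_phase hγ hβ _ p).const_mul _

theorem transform_eval_mul_cexp (hs : s ≠ 0) (p : Polynomial ℂ) (z : ℂ) :
    transform s t (fun w => p.eval w * cexp (γ * w ^ 2 / 2)) z =
      (1 / csqrt s * (Real.pi : ℂ)⁻¹ * cexp (t * z ^ 2 / (2 * s))) *
        planeAverage γ (-(starRingEnd ℂ) t / s) (z / s) p := by
  rw [transform, integral_gaussian]
  simp_rw [gaussianDensity_smul_kernel_mul hs]
  exact integral_const_mul _ _

theorem transform_X_mul (hs : s ≠ 0) (hγ : ‖γ‖ < 1) (hβ : ‖-(starRingEnd ℂ) t / s‖ < 1)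
    (p : Polynomial ℂ) (z : ℂ) :
    (s + (starRingEnd ℂ) t * γ) *
        transform s t (fun w => (Polynomial.X * p).eval w * cexp (γ * w ^ 2 / 2)) z =
      z * transform s t (fun w => p.eval w * cexp (γ * w ^ 2 / 2)) z -
        (starRingEnd ℂ) t *
          transform s t (fun w => (Polynomial.derivative p).eval w * cexp (γ * w ^ 2 / 2)) z := by
  have h := planeAverage_X_mul hγ hβ (z / s) p
  simp only [transform_eval_mul_cexp hs]
  have h' : (s + (starRingEnd ℂ) t * γ) *
        planeAverage γ (-(starRingEnd ℂ) t / s) (z / s) (Polynomial.X * p) =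
      z * planeAverage γ (-(starRingEnd ℂ) t / s) (z / s) p - (starRingEnd ℂ) t *
        planeAverage γ (-(starRingEnd ℂ) t / s) (z / s) (Polynomial.derivative p) := by
    have e1 : s + (starRingEnd ℂ) t * γ = s * (1 - γ * (-(starRingEnd ℂ) t / s)) := by
      field_simp; ring
    rw [e1, mul_assoc, h]
    field_simp
    ring
  linear_combination (1 / csqrt s * (Real.pi : ℂ)⁻¹ * cexp (t * z ^ 2 / (2 * s))) * h'

theorem transform_add (hs : s ≠ 0) (hγ : ‖γ‖ < 1) (hβ : ‖-(starRingEnd ℂ) t / s‖ < 1)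
    (p q : Polynomial ℂ) (z : ℂ) :
    transform s t (fun w => (p + q).eval w * cexp (γ * w ^ 2 / 2)) z =
      transform s t (fun w => p.eval w * cexp (γ * w ^ 2 / 2)) z +
        transform s t (fun w => q.eval w * cexp (γ * w ^ 2 / 2)) z := by
  simp only [transform_eval_mul_cexp hs, planeAverage_add hγ hβ]
  ring

theorem transform_C_mul (hs : s ≠ 0) (c : ℂ) (p : Polynomial ℂ) (z : ℂ) :
    transform s t (fun w => (Polynomial.C c * p).eval w * cexp (γ * w ^ 2 / 2)) z =
      c * transform s t (fun w => p.eval w * cexp (γ * w ^ 2 / 2)) z := by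
  simp only [transform_eval_mul_cexp hs, planeAverage_C_mul]
  ring

theorem transform_one (hs : s ≠ 0) (hγ : ‖γ‖ < 1) (hβ : ‖-(starRingEnd ℂ) t / s‖ < 1)
    (hμ : s + (starRingEnd ℂ) t * γ ≠ 0)
    (hfix : γ * (s * (s + (starRingEnd ℂ) t * γ) - 1) = t * (s + (starRingEnd ℂ) t * γ)) (z : ℂ) :
    transform s t (fun w => (1 : Polynomial ℂ).eval w * cexp (γ * w ^ 2 / 2)) z =
      eigenval s t γ 0 * cexp (γ * z ^ 2 / 2) := by
  have e1 : 1 - γ * (-(starRingEnd ℂ) t / s) = (s + (starRingEnd ℂ) t * γ) / s := by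
    field_simp; ring
  have hpi : (Real.pi : ℂ) ≠ 0 := by exact_mod_cast Real.pi_ne_zero
  rw [transform_eval_mul_cexp hs, planeAverage_one hγ hβ, e1, eigenval, one_div_div, pow_zero]
  -- This is the fixed-point relation `t/s + γ/(sμ) = γ`.
  have e2 : cexp (t * z ^ 2 / (2 * s)) *
      cexp (γ * (z / s) ^ 2 / (2 * ((s + (starRingEnd ℂ) t * γ) / s))) =
      cexp (γ * z ^ 2 / 2) := by
    rw [← Complex.exp_add]
    congr 1
    generalize s + (starRingEnd ℂ) t * γ = μ at *
    field_simp
    linear_combination (-z ^ 2) * hfix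
  rw [← e2]
  field_simp

/-- The functions `P_n exp (γ z² / 2)` are mapped to multiples of themselves. -/
theorem transform_hermitePoly (hs : s ≠ 0) (hγ : ‖γ‖ < 1) (hβ : ‖-(starRingEnd ℂ) t / s‖ < 1)
    (hμ : s + (starRingEnd ℂ) t * γ ≠ 0)
    (hfix : γ * (s * (s + (starRingEnd ℂ) t * γ) - 1) = t * (s + (starRingEnd ℂ) t * γ))
    {a b : ℂ} (hab : 2 * b * ((s + (starRingEnd ℂ) t * γ) ^ 2 - 1) =
      a ^ 2 * (starRingEnd ℂ) t * (s + (starRingEnd ℂ) t * γ)) (n : ℕ) (z : ℂ) :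
    transform s t (fun w => (hermitePoly a b n).eval w * cexp (γ * w ^ 2 / 2)) z =
      eigenval s t γ n * ((hermitePoly a b n).eval z * cexp (γ * z ^ 2 / 2)) := by
  have hev : ∀ n, (s + (starRingEnd ℂ) t * γ) * eigenval s t γ (n + 1) = eigenval s t γ n := by
    intro n
    rw [eigenval, eigenval, pow_succ]
    field_simp
  have hstep : ∀ n, (s + (starRingEnd ℂ) t * γ) *
      transform s t (fun w => (hermitePoly a b (n + 1)).eval w * cexp (γ * w ^ 2 / 2)) z =
      a * z * transform s t (fun w => (hermitePoly a b n).eval w * cexp (γ * w ^ 2 / 2)) z +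
      (2 * b * (s + (starRingEnd ℂ) t * γ) - a ^ 2 * (starRingEnd ℂ) t) * n *
        transform s t (fun w => (hermitePoly a b (n - 1)).eval w * cexp (γ * w ^ 2 / 2)) z := by
    intro n
    have h := transform_X_mul hs hγ hβ (hermitePoly a b n) z
    rw [derivative_hermitePoly, transform_C_mul hs] at h
    rw [hermitePoly_succ, transform_add hs hγ hβ, mul_assoc, transform_C_mul hs, transform_C_mul hs]
    linear_combination a * h
  induction n using Nat.twoStepInduction with
  | zero => simpa [hermitePoly] using transform_one hs hγ hβ hμ hfix z
  | one =>
    apply mul_left_cancel₀ hμ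
    have h0 := transform_one hs hγ hβ hμ hfix z
    rw [hstep, ← mul_assoc, hev]
    simp only [hermitePoly, h0, Nat.cast_zero, Polynomial.eval_mul, Polynomial.eval_C,
      Polynomial.eval_X]
    ring
  | more n h1 h2 =>
    apply mul_left_cancel₀ hμ
    have e1 : (s + (starRingEnd ℂ) t * γ) * eigenval s t γ (n + 2) = eigenval s t γ (n + 1) :=
      hev (n + 1)
    rw [hstep, h2, Nat.add_sub_cancel, h1, ← mul_assoc (_ + _) (eigenval _ _ _ _), e1, ← hev n]
    simp only [hermitePoly, Polynomial.eval_add, Polynomial.eval_mul, Polynomial.eval_C,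
      Polynomial.eval_X]
    push_cast
    -- As `λ_n = μ λ_{n+1}`, the recursion closes exactly when `(2bμ - a² t̄)μ = 2b`, which is
    -- `hab`.
    linear_combination ((n : ℂ) + 1) * eigenval s t γ (n + 1) *
      ((hermitePoly a b n).eval z * cexp (γ * z ^ 2 / 2)) * hab

theorem norm_eigenval (hs : s ≠ 0) (hμ : ‖s + (starRingEnd ℂ) t * γ‖ = 1) (n : ℕ) :
    ‖eigenval s t γ n‖ = 1 := by
  have : Real.sqrt ‖s‖ ≠ 0 := (Real.sqrt_pos.2 (norm_pos_iff.2 hs)).ne'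
  rw [eigenval, norm_mul, norm_mul, norm_div, norm_div, norm_pow, hμ, norm_csqrt, norm_csqrt,
    norm_div, hμ]
  simp [this]

theorem isEigenvector_T {f : Fock} {c : ℂ} (hf : f ≠ 0)
    (hint : ∀ z, Integrable (fun w => kernel s t z w * (f : ℂ → ℂ) w) gaussian)
    (htr : ∀ z, transform s t (f : ℂ → ℂ) z = c * (f : ℂ → ℂ) z) :
    IsEigenvector (T s t) c f := by
  have h : transform s t (f : ℂ → ℂ) = ((c • f : Fock) : ℂ → ℂ) := by
    funext z
    rw [htr]
    rfl
  exact ⟨hf, ⟨hint, h ▸ (c • f).2⟩, Subtype.ext h⟩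

end Transform

end FockIntegral

end

/-! ### Proof of the theorem -/

theorem theoremD (s t : ℂ) (hst : ‖s‖ ^ 2 = ‖t‖ ^ 2 + 1) (hs : |s.re| < 1) :
    ∃ γ : ℂ, FockIntegral.IsDiskRoot s t γ ∧
      (∀ γ' : ℂ, FockIntegral.IsDiskRoot s t γ' → γ' = γ) ∧
      s + (starRingEnd ℂ) t * γ ≠ 0 ∧
      (s + (starRingEnd ℂ) t * γ) ^ 2 - 1 ≠ 0 ∧
      ∃ ρ : ℝ, 0 < ρ ∧
        (ρ : ℂ) ^ 2 =
          (1 + γ) * ((s - (starRingEnd ℂ) t) * (s + (starRingEnd ℂ) t * γ) - 1) /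
            (2 * ((s + (starRingEnd ℂ) t * γ) ^ 2 - 1)) ∧
        ∀ n : ℕ,
          ‖FockIntegral.eigenval s t γ n‖ = 1 ∧
          FockIntegral.IsEigenvalue (FockIntegral.T s t) (FockIntegral.eigenval s t γ n) ∧
          (∀ z : ℂ, MeasureTheory.Integrable (FockIntegral.integrandQ γ ρ n z)) ∧
          (∃ P : Polynomial ℂ, P.degree = n ∧ ∀ z : ℂ, FockIntegral.Q γ ρ n z = P.eval z) ∧
          ∃ f : FockIntegral.Fock,
            (∀ z : ℂ, (f : ℂ → ℂ) z = FockIntegral.Q γ ρ n z * Complex.exp (γ * z ^ 2 / 2)) ∧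
            FockIntegral.IsEigenvector (FockIntegral.T s t)
              (FockIntegral.eigenval s t γ n) f := by
  obtain ⟨γ, hroot, huniq, hnμ, hμ2, hfix, ρ, hρ, hρeq⟩ :=
    FockIntegral.exists_diskRoot s t hst hs
  have hγ := hroot.1
  have hs0 : s ≠ 0 := fun h => by
    rw [h] at hst
    simp only [norm_zero] at hst
    nlinarith [sq_nonneg ‖t‖]
  have hμ : s + (starRingEnd ℂ) t * γ ≠ 0 := fun h => by simp [h] at hnμ
  have hβ : ‖-(starRingEnd ℂ) t / s‖ < 1 := by
    rw [norm_div, norm_neg, Complex.norm_conj, div_lt_one (norm_pos_iff.2 hs0)]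
    exact lt_of_pow_lt_pow_left₀ 2 (norm_nonneg _) (by linarith)
  have hρ0 : (ρ : ℂ) ≠ 0 := by exact_mod_cast hρ.ne'
  have h1γ := FockIntegral.one_add_ne_zero hγ
  obtain ⟨c, hc, hQ⟩ := FockIntegral.exists_Q_eq hγ hρ.ne'
  set a : ℂ := (1 + γ) / ρ with ha
  set b : ℂ := (1 + γ) / (2 * ρ ^ 2) - 1 with hb
  have ha0 : a ≠ 0 := div_ne_zero h1γ hρ0
  -- Clearing `ρ²` and using `μ - (1+γ)t̄ = s - t̄` turns this into the formula for `ρ²`.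
  have hab : 2 * b * ((s + (starRingEnd ℂ) t * γ) ^ 2 - 1) =
      a ^ 2 * (starRingEnd ℂ) t * (s + (starRingEnd ℂ) t * γ) := by
    rw [eq_div_iff (mul_ne_zero two_ne_zero hμ2)] at hρeq
    rw [ha, hb]
    field_simp
    linear_combination -hρeq
  refine ⟨γ, hroot, huniq, hμ, hμ2, ρ, hρ, hρeq, fun n => ?_⟩
  set P : Polynomial ℂ := Polynomial.C c * FockIntegral.hermitePoly a b n with hP
  have hPdeg : P.degree = n := by
    rw [hP, Polynomial.degree_C_mul hc, FockIntegral.degree_hermitePoly a b ha0]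
  have hQP : ∀ z, FockIntegral.Q γ ρ n z = P.eval z := fun z => by
    rw [hQ, hP, Polynomial.eval_mul, Polynomial.eval_C]
  let f : FockIntegral.Fock := ⟨_, FockIntegral.eval_mul_cexp_mem_Fock hγ P⟩
  have hf0 : f ≠ 0 := by
    intro h
    have hP0 : P = 0 := by
      apply Polynomial.funext
      intro z
      have : P.eval z * Complex.exp (γ * z ^ 2 / 2) = 0 := congrFun (congrArg Subtype.val h) z
      simpa [Complex.exp_ne_zero] using this
    rw [hP0, Polynomial.degree_zero] at hPdeg
    exact absurd hPdeg (by simp)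
  have hvec : FockIntegral.IsEigenvector (FockIntegral.T s t) (FockIntegral.eigenval s t γ n) f := by
    refine FockIntegral.isEigenvector_T hf0
      (fun z => FockIntegral.integrable_kernel_mul hs0 hγ hβ P z) fun z => ?_
    change FockIntegral.transform s t
      (fun w => P.eval w * Complex.exp (γ * w ^ 2 / 2)) z =
        _ * (P.eval z * Complex.exp (γ * z ^ 2 / 2))
    rw [hP, FockIntegral.transform_C_mul hs0,
      FockIntegral.transform_hermitePoly hs0 hγ hβ hμ hfix hab, Polynomial.eval_mul,
      Polynomial.eval_C]
    ring
  exact ⟨FockIntegral.norm_eigenval hs0 hnμ n, ⟨f, hvec⟩,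
    FockIntegral.integrable_integrandQ hγ ρ n, ⟨P, hPdeg, hQP⟩, f,
    fun z => by rw [hQP], hvec⟩
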